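/- Let $d\ge 0$ be an integer and let $\mathcal M\subset\mathbb R^d$ be a nonempty compact set with positive reach, i.e. there is $r>0$ such that every $x\in\mathbb R^d$ with $d_{\mathcal M}(x)<r$ has a unique closest point in $\mathcal M$, where $d_{\mathcal M}(x)=\inf_{y\in\mathcal M}|x-y|$. Let $W:\mathbb R^d\to\mathbb R$ be of class $C^2$, symmetric ($W(-x)=W(x)$), semiconvex ($x\mapsto W(x)-\tfrac{\lambda}{2}|x|^2$ is convex for some $\lambda\in\mathbb R$), bounded from below, and of at most quadratic growth at infinity ($W(x)=O(|x|^2)$ as $|x|\to\infty$). Let $\mathcal P_2(\mathbb R^d)$ be the set of Borel probability measures on $\mathbb R^d$ with finite second moment, endowed with the quadratic Wasserstein distance $d_2$, and let $\mathcal P(\mathcal M)\subset\mathcal P_2(\mathbb R^d)$ be the set of those supported in $\mathcal M$. With $W*\rho(x)=\int_{\mathbb R^d}W(x-y)\,\mathrm d\rho(y)$, define for $\rho\in\mathcal P_2(\mathbb R^d)$ and $\varepsilon>0$ $$E(\rho)=\begin{cases}\frac12\int_{\mathcal M}W*\rho\,\mathrm d\rho&\text{if }\rho\in\mathcal P(\mathcal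 M),\\ \infty&\text{otherwise,}\end{cases}\qquad E_\varepsilon(\rho)=\frac12\int_{\mathbb R^d}W*\rho\,\mathrm d\rho+\frac1\varepsilon\int_{\mathbb R^d}d_{\mathcal M}^2\,\mathrm d\rho .$$ Then: 1. For every $\varepsilon>0$ the functional $E_\varepsilon$ has a minimizer on $\mathcal P_2(\mathbb R^d)$. 2. For every choice of minimizers $\rho_\varepsilon^*$ of $E_\varepsilon$, $\varepsilon>0$, and every sequence $\varepsilon_n>0$ with $\varepsilon_n\to0$, there are a subsequence $(\varepsilon_{n_k})_k$ and a measure $\rho^*\in\mathcal P(\mathcal M)$ such that $d_2(\rho_{\varepsilon_{n_k}}^*,\rho^*)\to0$ as $k\to\infty$ and $\rho^*$ minimizes $E$ on $\mathcal P_2(\mathbb R^d)$. -/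

import Mathlib

open MeasureTheory Filter Topology
open scoped ENNReal

noncomputable section

namespace AttractingManifold

/-- `ℝ^d` with the Euclidean norm. -/
abbrev Space (d : ℕ) : Type := EuclideanSpace ℝ (Fin d)

/-- `P₂(ℝ^d)`: the Borel probability measures on `ℝ^d` with finite second moment. -/
abbrev P2 (d : ℕ) : Type :=
  {ρ : ProbabilityMeasure (Space d) // ∫⁻ x, ‖x‖ₑ ^ 2 ∂(ρ : Measure (Space d)) < ∞}

/-- The Borel measure underlying an element of `P₂(ℝ^d)`. -/
abbrev P2.meas {d : ℕ} (ρ : P2 d) : Measure (Space d) := (ρ.1 : Measure (Space d))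

/-- `P(M)`: the measures supported in `M`. For closed `M`, having support contained in `M` is the
same as giving no mass to the complement of `M`; for compact `M` every such probability measure
has finite second moment. -/
def supportedIn {d : ℕ} (M : Set (Space d)) : Set (P2 d) := {ρ | ρ.meas Mᶜ = 0}

/-- The transport plans from `ρ₀` to `ρ₁`. -/
def transportPlans {d : ℕ} (ρ₀ ρ₁ : P2 d) : Set (ProbabilityMeasure (Space d × Space d)) :=
  {π | (π : Measure (Space d × Space d)).map Prod.fst = ρ₀.meas ∧
       (π : Measure (Space d × Space d)).map Prod.snd = ρ₁.meas}

/-- The quadratic Wasserstein distance `d₂`, with values in `[0,∞]` (it is finite on `P₂`). -/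
def wasserstein {d : ℕ} (ρ₀ ρ₁ : P2 d) : ℝ≥0∞ :=
  ⨅ π ∈ transportPlans ρ₀ ρ₁,
    (∫⁻ z, edist z.1 z.2 ^ 2 ∂(π : Measure (Space d × Space d))) ^ (1 / 2 : ℝ)

/-- The reach of `M`: the supremum of the radii `r` such that every point at distance less than
`r` from `M` has a unique closest point in `M`. -/
def reach {d : ℕ} (M : Set (Space d)) : ℝ≥0∞ :=
  sSup {r : ℝ≥0∞ | ∀ x, Metric.infEDist x M < r →
    ∃! y, y ∈ M ∧ edist x y = Metric.infEDist x M}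

/-- The assumptions on the interaction potential: `C²`, symmetric, semiconvex, bounded from below,
with at most quadratic growth at infinity. -/
structure IsAdmissiblePotential {d : ℕ} (W : Space d → ℝ) : Prop where
  contDiff : ContDiff ℝ 2 W
  symm : ∀ x, W (-x) = W x
  semiconvex : ∃ l : ℝ, ConvexOn ℝ Set.univ (fun x => W x - l / 2 * ‖x‖ ^ 2)
  bddBelow : BddBelow (Set.range W)
  growth : W =O[Bornology.cobounded (Space d)] (fun x => ‖x‖ ^ 2)

/-- The convolution `W * ρ`. -/
def conv {d : ℕ} (W : Space d → ℝ) (ρ : P2 d) (x : Space d) : ℝ :=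
  ∫ y, W (x - y) ∂ρ.meas

open Classical in
/-- The interaction energy `E` on `P₂(ℝ^d)`, equal to `∞` outside `P(M)`. -/
def energy {d : ℕ} (W : Space d → ℝ) (M : Set (Space d)) (ρ : P2 d) : EReal :=
  if ρ ∈ supportedIn M then (((1 / 2 : ℝ) * ∫ x in M, conv W ρ x ∂ρ.meas : ℝ) : EReal) else ⊤

/-- The `ε`-interaction energy `E_ε` on `P₂(ℝ^d)`. For admissible `W` all the integrands are
integrable, so that it is finite on `P₂(ℝ^d)`. -/
def energyEps {d : ℕ} (W : Space d → ℝ) (M : Set (Space d)) (ε : ℝ) (ρ : P2 d) : EReal :=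
  (((1 / 2 : ℝ) * ∫ x, conv W ρ x ∂ρ.meas
    + 1 / ε * ∫ x, Metric.infDist x M ^ 2 ∂ρ.meas : ℝ) : EReal)

/-- `ρ` is a minimizer of the functional `F` on `P₂(ℝ^d)`. -/
def IsMinimizer {d : ℕ} (F : P2 d → EReal) (ρ : P2 d) : Prop := ∀ μ, F ρ ≤ F μ

end AttractingManifold

end

/-!
Compare a minimizer of `E_ε` with a competitor supported in `M`: as the interaction energy is
bounded below, the mean squared distance to `M` of the minimizers is `O(ε)`. Sublevel sets of the
mean squared distance are weakly compact (they are tight), and both parts of the energy are weakly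
lower semicontinuous, so that the direct method gives minimizers of `E_ε`, and weak limits of them
as `ε → 0` are supported in `M` and minimize `E`.

Weak convergence to a measure on `M` improves to `d₂`-convergence when the mean squared distance to
`M` tends to zero. Finitely many small cells whose boundaries are null for the limit cover `M`, so
that the masses of the cells converge. The mass common to both measures is moved within the cells,
and the remaining mass, which tends to zero, is moved by a product coupling, at a cost of at most
`2 d_M(x)² + 2 diam(M)²` per unit of mass starting from `x`.
-/

noncomputable section

namespace AttractingManifold

section Coupling

open scoped ProbabilityTheory

lemma sum_tsub_eq_sum_tsub {ι : Type*} [Fintype ι] {p q : ι → ℝ≥0∞}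
    (h : ∑ i, p i = ∑ i, q i) (hp : ∑ i, p i ≠ ∞) :
    ∑ i, (p i - q i) = ∑ i, (q i - p i) := by
  have hmin : ∑ i, min (p i) (q i) ≠ ∞ :=
    ne_top_of_le_ne_top hp (Finset.sum_le_sum fun _ _ => min_le_left _ _)
  refine (ENNReal.add_left_inj hmin).1 ?_
  calc ∑ i, (p i - q i) + ∑ i, min (p i) (q i) = ∑ i, p i := by
        simp_rw [← Finset.sum_add_distrib, tsub_add_min]
    _ = ∑ i, q i := h
    _ = ∑ i, (q i - p i) + ∑ i, min (p i) (q i) := by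
        simp_rw [← Finset.sum_add_distrib, min_comm (p _), tsub_add_min]

variable {X Y ι : Type*} [MeasurableSpace X] [MeasurableSpace Y]

/-- `π` is a coupling (transport plan) of the measures `μ` and `ν`, not necessarily of mass one. -/
structure IsCoupling (π : Measure (X × Y)) (μ : Measure X) (ν : Measure Y) : Prop where
  map_fst : π.map Prod.fst = μ
  map_snd : π.map Prod.snd = ν

lemma IsCoupling.add {π π' : Measure (X × Y)} {μ μ' : Measure X} {ν ν' : Measure Y}
    (h : IsCoupling π μ ν) (h' : IsCoupling π' μ' ν') : IsCoupling (π + π') (μ + μ') (ν + ν') where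
  map_fst := by rw [Measure.map_add _ _ measurable_fst, h.map_fst, h'.map_fst]
  map_snd := by rw [Measure.map_add _ _ measurable_snd, h.map_snd, h'.map_snd]

lemma IsCoupling.sum {s : Finset ι} {π : ι → Measure (X × Y)} {μ : ι → Measure X}
    {ν : ι → Measure Y} (h : ∀ i ∈ s, IsCoupling (π i) (μ i) (ν i)) :
    IsCoupling (∑ i ∈ s, π i) (∑ i ∈ s, μ i) (∑ i ∈ s, ν i) where
  map_fst := (Measure.map_finset_sum measurable_fst.aemeasurable).trans
    (Finset.sum_congr rfl fun i hi => (h i hi).map_fst)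
  map_snd := (Measure.map_finset_sum measurable_snd.aemeasurable).trans
    (Finset.sum_congr rfl fun i hi => (h i hi).map_snd)

lemma IsCoupling.isProbabilityMeasure {π : Measure (X × Y)} {μ : Measure X} {ν : Measure Y}
    [IsProbabilityMeasure μ] (h : IsCoupling π μ ν) : IsProbabilityMeasure π := by
  have : IsProbabilityMeasure (π.map Prod.fst) := h.map_fst ▸ inferInstance
  exact Measure.isProbabilityMeasure_of_map Prod.fst

/-- The product of two finite measures of equal total mass, rescaled to be a coupling of them.
The junk value `0⁻¹ = ∞` is harmless here, since it only rescales the zero measure. -/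
def productCoupling (μ : Measure X) (ν : Measure Y) : Measure (X × Y) :=
  (μ Set.univ)⁻¹ • μ.prod ν

section productCoupling

variable {μ : Measure X} {ν : Measure Y}

lemma isCoupling_productCoupling (h : μ Set.univ = ν Set.univ) (hμ : μ Set.univ ≠ ∞) :
    IsCoupling (productCoupling μ ν) μ ν := by
  have : IsFiniteMeasure μ := ⟨hμ.lt_top⟩
  have : IsFiniteMeasure ν := ⟨h ▸ hμ.lt_top⟩
  rcases eq_or_ne (μ Set.univ) 0 with h0 | h0
  · have hμ0 : μ = 0 := Measure.measure_univ_eq_zero.1 h0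
    have hν0 : ν = 0 := Measure.measure_univ_eq_zero.1 (h ▸ h0)
    constructor <;> simp [productCoupling, hμ0, hν0]
  · constructor
    · rw [productCoupling, Measure.map_smul, Measure.map_fst_prod, ← h, smul_smul,
        ENNReal.inv_mul_cancel h0 hμ, one_smul]
    · rw [productCoupling, Measure.map_smul, Measure.map_snd_prod, smul_smul,
        ENNReal.inv_mul_cancel h0 hμ, one_smul]

lemma lintegral_productCoupling_le (h : μ Set.univ = ν Set.univ) (hμ : μ Set.univ ≠ ∞)
    {c : X × Y → ℝ≥0∞} {g : X → ℝ≥0∞} (hc : ∀ᵐ x ∂μ, ∀ᵐ y ∂ν, c (x, y) ≤ g x) :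
    ∫⁻ z, c z ∂productCoupling μ ν ≤ ∫⁻ x, g x ∂μ := by
  have : IsFiniteMeasure ν := ⟨h ▸ hμ.lt_top⟩
  rcases eq_or_ne (μ Set.univ) 0 with h0 | h0
  · simp [productCoupling, Measure.measure_univ_eq_zero.1 h0]
  · calc ∫⁻ z, c z ∂productCoupling μ ν
        = (μ Set.univ)⁻¹ * ∫⁻ z, c z ∂μ.prod ν := lintegral_smul_measure _ _
      _ ≤ (μ Set.univ)⁻¹ * ∫⁻ x, ∫⁻ _, g x ∂ν ∂μ := by
        gcongr
        exact (lintegral_prod_le c).trans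
          (lintegral_mono_ae (hc.mono fun _ hx => lintegral_mono_ae hx))
      _ = ∫⁻ x, g x ∂μ := by
        simp_rw [lintegral_const, ← h]
        rw [lintegral_mul_const' _ _ hμ, mul_comm, mul_assoc, ENNReal.mul_inv_cancel h0 hμ,
          mul_one]

end productCoupling

lemma smul_cond_apply_univ {μ : Measure X} [IsFiniteMeasure μ] {s : Set X} {a : ℝ≥0∞}
    (ha : a ≤ μ s) : (a • μ[|s]) Set.univ = a := by
  rcases eq_or_ne (μ s) 0 with hs | hs
  · simp [le_zero_iff.1 (ha.trans_eq hs)]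
  · have := ProbabilityTheory.cond_isProbabilityMeasure hs
    simp

/-- The masses of the fibres of `T`, the cells of the partition of the space given by `T`. -/
def fiberMass (μ : Measure X) (T : X → ι) : ι → ℝ≥0∞ := fun i => μ (T ⁻¹' {i})

lemma fiberMass_ne_top {μ : Measure X} [IsFiniteMeasure μ] {T : X → ι} (i : ι) :
    fiberMass μ T i ≠ ∞ :=
  measure_ne_top _ _

variable [Fintype ι]

/-- The measure which has mass `w i` on the fibre of `T` over `i` and is there proportional
to `μ`. -/
def fiberMixture (μ : Measure X) (T : X → ι) (w : ι → ℝ≥0∞) : Measure X :=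
  ∑ i, w i • μ[|T ⁻¹' {i}]

section fiberMixture

variable {μ : Measure X} {T : X → ι}

lemma fiberMixture_add (w w' : ι → ℝ≥0∞) :
    fiberMixture μ T (w + w') = fiberMixture μ T w + fiberMixture μ T w' := by
  simp only [fiberMixture, Pi.add_apply, add_smul, Finset.sum_add_distrib]

lemma fiberMixture_absolutelyContinuous (w : ι → ℝ≥0∞) : fiberMixture μ T w ≪ μ := by
  intro s hs
  simp only [fiberMixture, Measure.finsetSum_apply, Measure.smul_apply, smul_eq_mul]
  exact Finset.sum_eq_zero fun i _ => by
    rw [ProbabilityTheory.cond_absolutelyContinuous hs, mul_zero]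

variable [IsFiniteMeasure μ]

lemma fiberMixture_apply_univ {w : ι → ℝ≥0∞} (hw : w ≤ fiberMass μ T) :
    fiberMixture μ T w Set.univ = ∑ i, w i := by
  rw [fiberMixture, Measure.finsetSum_apply]
  exact Finset.sum_congr rfl fun i _ => smul_cond_apply_univ (hw i)

variable [MeasurableSpace ι] [DiscreteMeasurableSpace ι]

lemma fiberMixture_fiberMass (hT : Measurable T) : fiberMixture μ T (fiberMass μ T) = μ :=
  ProbabilityTheory.sum_meas_smul_cond_fiber hT μ

lemma sum_fiberMass (hT : Measurable T) : ∑ i, fiberMass μ T i = μ Set.univ := by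
  rw [← fiberMixture_apply_univ le_rfl, fiberMixture_fiberMass hT]

lemma fiberMixture_inf_add_fiberMixture_tsub (hT : Measurable T) (w : ι → ℝ≥0∞) :
    fiberMixture μ T (fiberMass μ T ⊓ w) + fiberMixture μ T (fiberMass μ T - w) = μ := by
  have hw : fiberMass μ T ⊓ w + (fiberMass μ T - w) = fiberMass μ T :=
    funext fun i => (add_comm _ _).trans tsub_add_min
  rw [← fiberMixture_add, hw, fiberMixture_fiberMass hT]

lemma lintegral_fiberMixture_tsub_le (hT : Measurable T) (w : ι → ℝ≥0∞) (g : X → ℝ≥0∞) :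
    ∫⁻ x, g x ∂fiberMixture μ T (fiberMass μ T - w) ≤ ∫⁻ x, g x ∂μ := by
  conv_rhs => rw [← fiberMixture_inf_add_fiberMixture_tsub (μ := μ) hT w]
  exact lintegral_mono' (Measure.le_add_left le_rfl) le_rfl

end fiberMixture

/-- The coupling which transports the mass `w i` from the fibre of `S` over `i` to the fibre of `T`
over `i`. -/
def fiberwiseCoupling (μ : Measure X) (ν : Measure Y) (S : X → ι) (T : Y → ι) (w : ι → ℝ≥0∞) :
    Measure (X × Y) :=
  ∑ i, productCoupling (w i • μ[|S ⁻¹' {i}]) (w i • ν[|T ⁻¹' {i}])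

variable {μ : Measure X} {ν : Measure Y} [IsFiniteMeasure μ] [IsFiniteMeasure ν]
  {S : X → ι} {T : Y → ι}

lemma isCoupling_fiberwiseCoupling {w : ι → ℝ≥0∞} (hμ : w ≤ fiberMass μ S)
    (hν : w ≤ fiberMass ν T) :
    IsCoupling (fiberwiseCoupling μ ν S T w) (fiberMixture μ S w) (fiberMixture ν T w) := by
  refine IsCoupling.sum fun i _ => isCoupling_productCoupling ?_ ?_
  · rw [smul_cond_apply_univ (hμ i), smul_cond_apply_univ (hν i)]
  · rw [smul_cond_apply_univ (hμ i)]
    exact ne_top_of_le_ne_top (fiberMass_ne_top i) (hμ i)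

variable [MeasurableSpace ι] [DiscreteMeasurableSpace ι]

lemma lintegral_fiberwiseCoupling_le (hS : Measurable S) (hT : Measurable T) {w : ι → ℝ≥0∞}
    (hμ : w ≤ fiberMass μ S) (hν : w ≤ fiberMass ν T) {c : X × Y → ℝ≥0∞} {δ : ℝ≥0∞}
    (hc : ∀ᵐ y ∂ν, ∀ x, S x = T y → c (x, y) ≤ δ) :
    ∫⁻ z, c z ∂fiberwiseCoupling μ ν S T w ≤ δ * ∑ i, w i := by
  rw [fiberwiseCoupling, lintegral_finsetSum_measure, Finset.mul_sum]
  refine Finset.sum_le_sum fun i _ => ?_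
  have hμi := smul_cond_apply_univ (hμ i)
  have hνi := smul_cond_apply_univ (hν i)
  have hfin : (w i • μ[|S ⁻¹' {i}]) Set.univ ≠ ∞ := by
    rw [hμi]
    exact ne_top_of_le_ne_top (fiberMass_ne_top i) (hμ i)
  have hcost : ∀ᵐ x ∂w i • μ[|S ⁻¹' {i}], ∀ᵐ y ∂w i • ν[|T ⁻¹' {i}], c (x, y) ≤ δ := by
    filter_upwards [Measure.ae_smul_measure
      (ProbabilityTheory.ae_cond_mem (hS (measurableSet_singleton i))) (w i)] with x hx
    refine Measure.ae_smul_measure ?_ (w i)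
    filter_upwards [ProbabilityTheory.ae_cond_mem (hT (measurableSet_singleton i)),
      ProbabilityTheory.cond_absolutelyContinuous.ae_le hc] with y hy hcy
    exact hcy x (Eq.trans hx (Eq.symm hy))
  calc ∫⁻ z, c z ∂productCoupling (w i • μ[|S ⁻¹' {i}]) (w i • ν[|T ⁻¹' {i}])
      ≤ ∫⁻ _, δ ∂w i • μ[|S ⁻¹' {i}] := lintegral_productCoupling_le (hμi.trans hνi.symm) hfin hcost
    _ = δ * w i := by rw [lintegral_const, hμi]

lemma fiberMixture_tsub_apply_univ_eq (h : μ Set.univ = ν Set.univ) (hS : Measurable S)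
    (hT : Measurable T) :
    fiberMixture μ S (fiberMass μ S - fiberMass ν T) Set.univ =
      fiberMixture ν T (fiberMass ν T - fiberMass μ S) Set.univ := by
  rw [fiberMixture_apply_univ tsub_le_self, fiberMixture_apply_univ tsub_le_self]
  refine sum_tsub_eq_sum_tsub ?_ ?_
  · rw [sum_fiberMass hS, sum_fiberMass hT, h]
  · rw [sum_fiberMass hS]
    exact measure_ne_top _ _

lemma exists_isCoupling_lintegral_le (h : μ Set.univ = ν Set.univ) (hS : Measurable S)
    (hT : Measurable T) {c : X × Y → ℝ≥0∞} {g : X → ℝ≥0∞} {δ R : ℝ≥0∞}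
    (hδ : ∀ᵐ y ∂ν, ∀ x, S x = T y → c (x, y) ≤ δ) (hR : ∀ᵐ y ∂ν, ∀ x, c (x, y) ≤ g x + R) :
    ∃ π : Measure (X × Y), IsCoupling π μ ν ∧ ∫⁻ z, c z ∂π ≤
      δ * μ Set.univ + (∫⁻ x, g x ∂μ + R * ∑ i, (fiberMass μ S i - fiberMass ν T i)) := by
  set p := fiberMass μ S
  set q := fiberMass ν T
  have hmass : fiberMixture μ S (p - q) Set.univ = ∑ i, (p i - q i) :=
    fiberMixture_apply_univ tsub_le_self
  have hmass_eq : fiberMixture μ S (p - q) Set.univ = fiberMixture ν T (q - p) Set.univ :=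
    fiberMixture_tsub_apply_univ_eq h hS hT
  have hmass_ne_top : fiberMixture μ S (p - q) Set.univ ≠ ∞ := by
    rw [hmass]
    exact ENNReal.sum_ne_top.2 fun i _ => ne_top_of_le_ne_top (fiberMass_ne_top i) tsub_le_self
  refine ⟨fiberwiseCoupling μ ν S T (p ⊓ q) +
    productCoupling (fiberMixture μ S (p - q)) (fiberMixture ν T (q - p)), ?_, ?_⟩
  · have hsum := (isCoupling_fiberwiseCoupling (μ := μ) (ν := ν) (w := p ⊓ q) inf_le_left
      inf_le_right).add (isCoupling_productCoupling hmass_eq hmass_ne_top)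
    have hν : fiberMixture ν T (p ⊓ q) + fiberMixture ν T (q - p) = ν := by
      rw [inf_comm]
      exact fiberMixture_inf_add_fiberMixture_tsub hT p
    rwa [fiberMixture_inf_add_fiberMixture_tsub hS, hν] at hsum
  · rw [lintegral_add_measure]
    gcongr
    · calc ∫⁻ z, c z ∂fiberwiseCoupling μ ν S T (p ⊓ q) ≤ δ * ∑ i, (p ⊓ q) i :=
            lintegral_fiberwiseCoupling_le hS hT inf_le_left inf_le_right hδ
        _ ≤ δ * μ Set.univ := by
          rw [← sum_fiberMass hS]
          gcongr with i
          exact min_le_left _ _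
    · calc ∫⁻ z, c z ∂productCoupling (fiberMixture μ S (p - q)) (fiberMixture ν T (q - p))
          ≤ ∫⁻ x, (g x + R) ∂fiberMixture μ S (p - q) :=
            lintegral_productCoupling_le hmass_eq hmass_ne_top (Eventually.of_forall fun x =>
              (fiberMixture_absolutelyContinuous _).ae_le (hR.mono fun y hy => hy x))
        _ = ∫⁻ x, g x ∂fiberMixture μ S (p - q) + R * ∑ i, (p i - q i) := by
          rw [lintegral_add_right _ measurable_const, lintegral_const, hmass]
        _ ≤ ∫⁻ x, g x ∂μ + R * ∑ i, (p i - q i) := by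
          gcongr ?_ + _
          exact lintegral_fiberMixture_tsub_le hS q g

end Coupling

section WeakConvergence

lemma frontier_iInter_subset {X ι : Type*} [TopologicalSpace X] [Finite ι] (s : ι → Set X) :
    frontier (⋂ i, s i) ⊆ ⋃ i, frontier (s i) := by
  rintro x ⟨hx, hx'⟩
  rw [interior_iInter_of_finite, Set.mem_iInter, not_forall] at hx'
  obtain ⟨i, hi⟩ := hx'
  exact Set.mem_iUnion.2 ⟨i, closure_mono (Set.iInter_subset s i) hx, hi⟩

lemma frontier_preimage_singleton_mem_subset {X ι : Type*} [TopologicalSpace X] [Finite ι]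
    (s : ι → Set X) (p : ι → Prop) :
    frontier ((fun x i => x ∈ s i) ⁻¹' {p}) ⊆ ⋃ i, frontier (s i) := by
  have hfib : (fun x i => x ∈ s i) ⁻¹' {p} = ⋂ i, {x | x ∈ s i ↔ p i} := by
    ext x
    simp [funext_iff]
  rw [hfib]
  refine (frontier_iInter_subset _).trans (Set.iUnion_mono fun i => ?_)
  by_cases hp : p i
  · simp [hp]
  · simp only [hp, iff_false]
    exact (frontier_compl (s i)).subset

lemma exists_finite_measurable_frontier_null {X : Type*} [PseudoMetricSpace X] [MeasurableSpace X]
    [OpensMeasurableSpace X] (ν : Measure X) [SFinite ν] {M : Set X} (hM : IsCompact M)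
    {ε : ℝ} (hε : 0 < ε) :
    ∃ (t : Finset X) (T : X → t → Prop), Measurable T ∧
      (∀ i, ν (frontier (T ⁻¹' {i})) = 0) ∧ ∀ x, ∀ y ∈ M, T x = T y → dist x y < ε := by
  have hball (x : X) : ∃ r ∈ Set.Ioo 0 (ε / 2), ν (frontier (Metric.ball x r)) = 0 := by
    simpa only [Metric.thickening_singleton] using
      exists_null_frontier_thickening ν {x} (half_pos hε)
  choose r hr hν using hball
  obtain ⟨t, -, ht⟩ := hM.elim_nhds_subcover (fun x => Metric.ball x (r x))
    fun x _ => Metric.ball_mem_nhds x (hr x).1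
  -- The cells are the atoms generated by the balls: `T x` records which of them contain `x`.
  refine ⟨t, fun x a => x ∈ Metric.ball a.1 (r a), ?_, fun i => ?_, fun x y hy hxy => ?_⟩
  · exact measurable_pi_iff.2 fun a => Metric.isOpen_ball.measurableSet.mem
  · exact measure_mono_null (frontier_preimage_singleton_mem_subset _ i)
      (measure_iUnion_null fun a => hν a)
  · obtain ⟨a, ha, hya⟩ := Set.mem_iUnion₂.1 (ht hy)
    have hxa : x ∈ Metric.ball a (r a) := (congrFun hxy ⟨a, ha⟩).mpr hya
    calc dist x y ≤ dist x a + dist y a := dist_triangle_right x y a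
      _ < ε / 2 + ε / 2 := add_lt_add (hxa.out.trans (hr a).2) (hya.out.trans (hr a).2)
      _ = ε := add_halves ε

lemma add_sq_le_two_mul_sq_add_two_mul_sq (a b : ℝ≥0∞) : (a + b) ^ 2 ≤ 2 * a ^ 2 + 2 * b ^ 2 := by
  have h := ENNReal.rpow_add_le_mul_rpow_add_rpow a b (p := 2) one_le_two
  rw [← mul_add]
  norm_num at h
  exact_mod_cast h

lemma edist_sq_le_infEDist_sq_add_ediam_sq {X : Type*} [PseudoEMetricSpace X] {M : Set X} {x y : X}
    (hy : y ∈ M) : edist x y ^ 2 ≤ 2 * Metric.infEDist x M ^ 2 + 2 * Metric.ediam M ^ 2 :=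
  (pow_le_pow_left' (Metric.edist_le_infEDist_add_ediam hy) 2).trans
    (add_sq_le_two_mul_sq_add_two_mul_sq _ _)

lemma exists_pos_ofReal_sq_le {η : ℝ≥0∞} (hη : 0 < η) :
    ∃ ε : ℝ, 0 < ε ∧ ENNReal.ofReal ε ^ 2 ≤ η := by
  have hlim : Tendsto (fun ε => ENNReal.ofReal ε ^ 2) (𝓝[>] 0) (𝓝 0) :=
    (((ENNReal.continuous_pow 2).comp ENNReal.continuous_ofReal).tendsto' 0 0 (by simp)).mono_left
      nhdsWithin_le_nhds
  exact (eventually_mem_nhdsWithin.and (ENNReal.tendsto_nhds_zero.1 hlim η hη)).exists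

lemma tendsto_sum_fiberMass_tsub {X ι L : Type*} [TopologicalSpace X] [MeasurableSpace X]
    [OpensMeasurableSpace X] [HasOuterApproxClosed X] [Fintype ι] {l : Filter L}
    {μ : L → ProbabilityMeasure X} {ν : ProbabilityMeasure X} (hμ : Tendsto μ l (𝓝 ν))
    {T : X → ι} (hT : ∀ i, (ν : Measure X) (frontier (T ⁻¹' {i})) = 0) :
    Tendsto (fun n => ∑ i, (fiberMass (μ n : Measure X) T i - fiberMass (ν : Measure X) T i))
      l (𝓝 0) := by
  rw [show (0 : ℝ≥0∞) = ∑ i, (fiberMass (ν : Measure X) T i - fiberMass (ν : Measure X) T i) by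
    simp]
  exact tendsto_finsetSum _ fun i _ => ENNReal.Tendsto.sub
    (ProbabilityMeasure.tendsto_measure_of_null_frontier_of_tendsto' hμ (hT i))
    tendsto_const_nhds (Or.inl (measure_ne_top _ _))

lemma eventually_exists_isCoupling_lintegral_edist_sq_le {X L : Type*} [PseudoMetricSpace X]
    [MeasurableSpace X] [OpensMeasurableSpace X] {l : Filter L} {μ : L → ProbabilityMeasure X}
    {ν : ProbabilityMeasure X} (hμ : Tendsto μ l (𝓝 ν)) {M : Set X} (hM : IsCompact M)
    (hν : ∀ᵐ y ∂(ν : Measure X), y ∈ M)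
    (hdist : Tendsto (fun n => ∫⁻ x, Metric.infEDist x M ^ 2 ∂(μ n : Measure X)) l (𝓝 0))
    {η : ℝ≥0∞} (hη : 0 < η) :
    ∀ᶠ n in l, ∃ π : Measure (X × X), IsCoupling π (μ n : Measure X) (ν : Measure X) ∧
      ∫⁻ z, edist z.1 z.2 ^ 2 ∂π ≤ η := by
  classical
  obtain ⟨ε, hε, hεη⟩ := exists_pos_ofReal_sq_le (ENNReal.half_pos hη.ne')
  obtain ⟨t, T, hTm, hTν, hTε⟩ := exists_finite_measurable_frontier_null (ν : Measure X) hM hε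
  have hdiam : 2 * Metric.ediam M ^ 2 ≠ ∞ :=
    ENNReal.mul_ne_top (by simp) (ENNReal.pow_ne_top hM.isBounded.ediam_ne_top)
  have hrem : Tendsto (fun n => 2 * ∫⁻ x, Metric.infEDist x M ^ 2 ∂(μ n : Measure X) +
      2 * Metric.ediam M ^ 2 *
        ∑ i, (fiberMass (μ n : Measure X) T i - fiberMass (ν : Measure X) T i)) l (𝓝 0) := by
    simpa using (ENNReal.Tendsto.const_mul hdist (Or.inr ENNReal.ofNat_ne_top)).add
      (ENNReal.Tendsto.const_mul (tendsto_sum_fiberMass_tsub hμ hTν) (Or.inr hdiam))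
  filter_upwards [ENNReal.tendsto_nhds_zero.1 hrem _ (ENNReal.half_pos hη.ne')] with n hn
  obtain ⟨π, hπ, hcost⟩ := exists_isCoupling_lintegral_le (μ := (μ n : Measure X))
    (ν := (ν : Measure X)) (by simp) hTm hTm (c := fun z => edist z.1 z.2 ^ 2)
    (δ := ENNReal.ofReal ε ^ 2)
    (hν.mono fun y hy x hxy => by
      gcongr
      exact (edist_dist x y).trans_le (ENNReal.ofReal_le_ofReal (hTε x y hy hxy).le))
    (hν.mono fun y hy x => edist_sq_le_infEDist_sq_add_ediam_sq hy)
  refine ⟨π, hπ, hcost.trans ?_⟩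
  rw [measure_univ, mul_one, lintegral_const_mul _ (by fun_prop)]
  exact (add_le_add hεη hn).trans_eq (ENNReal.add_halves η)

end WeakConvergence

section LowerSemicontinuity

lemma le_of_lowerSemicontinuous_of_tendsto {X L : Type*} [TopologicalSpace X] {l : Filter L}
    [l.NeBot] {f : X → ℝ} (hf : LowerSemicontinuous f) {u : L → X} {x : X} {a : ℝ}
    (hu : Tendsto u l (𝓝 x)) (hfu : Tendsto (f ∘ u) l (𝓝 a)) : f x ≤ a :=
  le_of_forall_lt_imp_le_of_dense fun y hy =>
    ge_of_tendsto hfu ((hu.eventually (hf x y hy)).mono fun _ => le_of_lt)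

variable {X : Type*} [TopologicalSpace X] [MeasurableSpace X] [OpensMeasurableSpace X]

lemma continuous_lintegral_of_le {f : X → ℝ≥0∞} (hf : Continuous f) {C : ℝ≥0∞} (hC : C ≠ ∞)
    (hfC : ∀ x, f x ≤ C) :
    Continuous fun μ : ProbabilityMeasure X => ∫⁻ x, f x ∂(μ : Measure X) := by
  have hfin (x : X) : f x ≠ ∞ := ne_top_of_le_ne_top hC (hfC x)
  let g : BoundedContinuousFunction X NNReal :=
    ⟨⟨fun x => (f x).toNNReal, ENNReal.continuousOn_toNNReal.comp_continuous hf hfin⟩,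
      C.toNNReal, fun x y => by
        have hle (z : X) : (f z).toNNReal ≤ C.toNNReal := ENNReal.toNNReal_mono hC (hfC z)
        exact abs_sub_le_of_nonneg_of_le NNReal.zero_le_coe (hle x) NNReal.zero_le_coe (hle y)⟩
  have hg (μ : ProbabilityMeasure X) :
      ∫⁻ x, f x ∂(μ : Measure X) = μ.toFiniteMeasure.testAgainstNN g := by
    rw [FiniteMeasure.testAgainstNN_coe_eq]
    exact lintegral_congr fun x => (ENNReal.coe_toNNReal (hfin x)).symm
  simp_rw [hg]
  exact ENNReal.continuous_coe.comp (ProbabilityMeasure.continuous_testAgainstNN_eval g)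

lemma lowerSemicontinuous_lintegral {f : X → ℝ≥0∞} (hf : Continuous f) :
    LowerSemicontinuous fun μ : ProbabilityMeasure X => ∫⁻ x, f x ∂(μ : Measure X) := by
  have htrunc (x : X) : f x = ⨆ n : ℕ, min (f x) n := by
    rw [← inf_iSup_eq, ENNReal.iSup_natCast, inf_top_eq]
  have hsup (μ : ProbabilityMeasure X) :
      ∫⁻ x, f x ∂(μ : Measure X) = ⨆ n : ℕ, ∫⁻ x, min (f x) n ∂(μ : Measure X) := by
    rw [← lintegral_iSup (fun n => by fun_prop) fun m n hmn x => by gcongr]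
    exact lintegral_congr htrunc
  simp_rw [hsup]
  exact lowerSemicontinuous_iSup fun n => (continuous_lintegral_of_le (hf.min continuous_const)
    (ENNReal.natCast_ne_top n) fun _ => min_le_right _ _).lowerSemicontinuous

lemma lowerSemicontinuousOn_integral {f : X → ℝ} (hf : Continuous f)
    (hbdd : BddBelow (Set.range f)) :
    LowerSemicontinuousOn (fun μ : ProbabilityMeasure X => ∫ x, f x ∂(μ : Measure X))
      {μ | Integrable f (μ : Measure X)} := by
  obtain ⟨c, hc⟩ := hbdd
  have hfc (x : X) : 0 ≤ f x - c := sub_nonneg.2 (hc ⟨x, rfl⟩)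
  have hint {μ : ProbabilityMeasure X} (hμ : Integrable f (μ : Measure X)) :
      ∫⁻ x, ENNReal.ofReal (f x - c) ∂(μ : Measure X) =
        ENNReal.ofReal (∫ x, f x ∂(μ : Measure X) - c) := by
    have hmean : ∫ x, (f x - c) ∂(μ : Measure X) = ∫ x, f x ∂(μ : Measure X) - c := by
      simp [integral_sub hμ (integrable_const c)]
    rw [← hmean]
    exact (ofReal_integral_eq_lintegral_ofReal (hμ.sub (integrable_const c))
      (Eventually.of_forall hfc)).symm
  have hcint {μ : ProbabilityMeasure X} (hμ : Integrable f (μ : Measure X)) :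
      c ≤ ∫ x, f x ∂(μ : Measure X) := by
    simpa using integral_mono (integrable_const c) hμ fun x => hc ⟨x, rfl⟩
  intro μ hμ y hy
  rcases lt_or_ge y c with hyc | hyc
  · filter_upwards [self_mem_nhdsWithin] with ν hν using hyc.trans_le (hcint hν)
  · have hlsc := lowerSemicontinuous_lintegral
      (ENNReal.continuous_ofReal.comp (hf.sub continuous_const)) μ (ENNReal.ofReal (y - c))
      ((ENNReal.ofReal_lt_ofReal_iff_of_nonneg (sub_nonneg.2 hyc)).2 (sub_lt_sub_right hy c)
        |>.trans_eq (hint hμ).symm)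
    filter_upwards [nhdsWithin_le_nhds hlsc, self_mem_nhdsWithin] with ν hν hνint
    have hlt := hν.trans_eq (hint hνint)
    rw [ENNReal.ofReal_lt_ofReal_iff_of_nonneg (sub_nonneg.2 hyc)] at hlt
    exact (sub_lt_sub_iff_right c).1 hlt

end LowerSemicontinuity

section Coercivity

lemma tendsto_infEDist_cocompact {X : Type*} [PseudoMetricSpace X] [ProperSpace X] {M : Set X}
    (hMb : Bornology.IsBounded M) (hM : M.Nonempty) :
    Tendsto (fun x => Metric.infEDist x M) (cocompact X) (𝓝 ∞) := by
  obtain ⟨m, hm⟩ := hM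
  have hdist : Tendsto (fun x => edist x m - Metric.ediam M) (cocompact X) (𝓝 ∞) := by
    simp_rw [edist_dist]
    simpa [ENNReal.top_sub hMb.ediam_ne_top] using ENNReal.Tendsto.sub
      (ENNReal.tendsto_ofReal_atTop.comp (tendsto_dist_right_cocompact_atTop m))
      tendsto_const_nhds (Or.inr hMb.ediam_ne_top)
  exact tendsto_nhds_top_mono' hdist fun x =>
    tsub_le_iff_right.2 (Metric.edist_le_infEDist_add_ediam hm)

lemma lintegral_enorm_sq_lt_top_of_infEDist {E : Type*} [SeminormedAddCommGroup E]
    [MeasurableSpace E] [OpensMeasurableSpace E] {M : Set E} (hMb : Bornology.IsBounded M)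
    (hM : M.Nonempty) {μ : Measure E} [IsFiniteMeasure μ]
    (hμ : ∫⁻ x, Metric.infEDist x M ^ 2 ∂μ < ∞) : ∫⁻ x, ‖x‖ₑ ^ 2 ∂μ < ∞ := by
  obtain ⟨m, hm⟩ := hM
  have hle (x : E) :
      ‖x‖ₑ ^ 2 ≤ 2 * Metric.infEDist x M ^ 2 + 2 * (Metric.ediam M + ‖m‖ₑ) ^ 2 := by
    refine le_trans ?_ (add_sq_le_two_mul_sq_add_two_mul_sq _ _)
    gcongr
    calc ‖x‖ₑ ≤ edist x m + ‖m‖ₑ := by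
          simpa only [edist_zero_right] using edist_triangle x m 0
      _ ≤ Metric.infEDist x M + Metric.ediam M + ‖m‖ₑ := by
        gcongr
        exact Metric.edist_le_infEDist_add_ediam hm
      _ = Metric.infEDist x M + (Metric.ediam M + ‖m‖ₑ) := add_assoc _ _ _
  refine (lintegral_mono hle).trans_lt ?_
  rw [lintegral_add_right _ measurable_const, lintegral_const_mul _ (by fun_prop), lintegral_const]
  have := hMb.ediam_ne_top
  finiteness

lemma isTightMeasureSet_setOf_lintegral_le {X : Type*} [TopologicalSpace X] [MeasurableSpace X]
    {f : X → ℝ≥0∞} (hf : Tendsto f (cocompact X) (𝓝 ∞)) (hfm : Measurable f) {C : ℝ≥0∞}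
    (hC : C ≠ ∞) :
    IsTightMeasureSet {μ : Measure X | ∫⁻ x, f x ∂μ ≤ C} := by
  rw [isTightMeasureSet_iff_exists_isCompact_measure_compl_le]
  intro ε hε
  have hlim : Tendsto (fun n : ℕ => C / n) atTop (𝓝 0) := by
    simpa using ENNReal.Tendsto.const_div ENNReal.tendsto_nat_nhds_top (Or.inr hC)
  obtain ⟨n, hnε, hn⟩ :=
    ((ENNReal.tendsto_nhds_zero.1 hlim ε hε).and (eventually_ne_atTop 0)).exists
  obtain ⟨K, hK, hKf⟩ := mem_cocompact.1
    (hf.eventually (eventually_ge_nhds (ENNReal.natCast_lt_top n)))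
  refine ⟨K, hK, fun μ hμ => ?_⟩
  calc μ Kᶜ ≤ μ {x | n ≤ f x} := measure_mono hKf
    _ ≤ (∫⁻ x, f x ∂μ) / n :=
      meas_ge_le_lintegral_div hfm.aemeasurable (by exact_mod_cast hn) (ENNReal.natCast_ne_top n)
    _ ≤ C / n := by gcongr; exact hμ
    _ ≤ ε := hnε

lemma isCompact_setOf_lintegral_le {X : Type*} [TopologicalSpace X] [T2Space X] [MeasurableSpace X]
    [BorelSpace X] {f : X → ℝ≥0∞} (hf : Continuous f)
    (hcoer : Tendsto f (cocompact X) (𝓝 ∞)) {C : ℝ≥0∞} (hC : C ≠ ∞) :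
    IsCompact {μ : ProbabilityMeasure X | ∫⁻ x, f x ∂(μ : Measure X) ≤ C} := by
  have hclosed : IsClosed {μ : ProbabilityMeasure X | ∫⁻ x, f x ∂(μ : Measure X) ≤ C} :=
    (lowerSemicontinuous_lintegral hf).isClosed_preimage C
  rw [← hclosed.closure_eq]
  refine isCompact_closure_of_isTightMeasureSet
    ((isTightMeasureSet_setOf_lintegral_le hcoer hf.measurable hC).subset ?_)
  rintro _ ⟨μ, hμ, rfl⟩
  exact hμ

end Coercivity

section Space

variable {d : ℕ}

lemma P2.memLp_id (ρ : P2 d) : MemLp id 2 ρ.meas :=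
  ⟨by fun_prop, (eLpNorm_lt_top_iff_lintegral_rpow_enorm_lt_top two_ne_zero ENNReal.ofNat_ne_top).2
    (by simpa using ρ.2)⟩

lemma IsCoupling.wasserstein_le {ρ₀ ρ₁ : P2 d} {π : Measure (Space d × Space d)}
    (hπ : IsCoupling π ρ₀.meas ρ₁.meas) :
    wasserstein ρ₀ ρ₁ ≤ (∫⁻ z, edist z.1 z.2 ^ 2 ∂π) ^ (1 / 2 : ℝ) :=
  iInf₂_le (⟨π, hπ.isProbabilityMeasure⟩ : ProbabilityMeasure (Space d × Space d))
    ⟨hπ.map_fst, hπ.map_snd⟩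

lemma tendsto_wasserstein {L : Type*} {l : Filter L} {ρ : L → P2 d} {μ : P2 d}
    (hρ : Tendsto ρ l (𝓝 μ)) {M : Set (Space d)} (hM : IsCompact M) (hμ : μ ∈ supportedIn M)
    (hdist : Tendsto (fun n => ∫⁻ x, Metric.infEDist x M ^ 2 ∂(ρ n).meas) l (𝓝 0)) :
    Tendsto (fun n => wasserstein (ρ n) μ) l (𝓝 0) := by
  refine ENNReal.tendsto_nhds_zero.2 fun η hη => ?_
  filter_upwards [eventually_exists_isCoupling_lintegral_edist_sq_le
    ((continuous_subtype_val.tendsto μ).comp hρ) hM hμ hdist (ENNReal.pow_pos hη 2)]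
    with n ⟨π, hπ, hcost⟩
  calc wasserstein (ρ n) μ ≤ (∫⁻ z, edist z.1 z.2 ^ 2 ∂π) ^ (1 / 2 : ℝ) := hπ.wasserstein_le
    _ ≤ (η ^ 2) ^ (1 / 2 : ℝ) := by gcongr
    _ = η := by rw [← ENNReal.rpow_natCast_mul]; norm_num

/-- The interaction part of the energies `E` and `E_ε`. -/
def interactionEnergy (W : Space d → ℝ) (ρ : P2 d) : ℝ :=
  1 / 2 * ∫ x, conv W ρ x ∂ρ.meas

/-- The penalization `∫ d_M² dρ` in `E_ε`. -/
def meanSqDist (M : Set (Space d)) (ρ : P2 d) : ℝ :=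
  ∫ x, Metric.infDist x M ^ 2 ∂ρ.meas

section Penalization

variable {M : Set (Space d)}

lemma meanSqDist_nonneg (M : Set (Space d)) (ρ : P2 d) : 0 ≤ meanSqDist M ρ :=
  integral_nonneg fun _ => sq_nonneg _

lemma integrable_infDist_sq (M : Set (Space d)) (ρ : P2 d) :
    Integrable (fun x => Metric.infDist x M ^ 2) ρ.meas := by
  have hle (x : Space d) : ‖Metric.infDist x M‖ ≤ Metric.infDist 0 M + ‖x‖ := by
    rw [Real.norm_of_nonneg Metric.infDist_nonneg, ← dist_zero_right]
    exact Metric.infDist_le_infDist_add_dist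
  exact (((memLp_const (Metric.infDist 0 M)).add ρ.memLp_id.norm).mono'
    (by fun_prop) (Eventually.of_forall hle)).integrable_sq

lemma lintegral_infEDist_sq (hM : M.Nonempty) (ρ : P2 d) :
    ∫⁻ x, Metric.infEDist x M ^ 2 ∂ρ.meas = ENNReal.ofReal (meanSqDist M ρ) := by
  rw [meanSqDist, ofReal_integral_eq_lintegral_ofReal (integrable_infDist_sq M ρ)
    (Eventually.of_forall fun x => sq_nonneg _)]
  refine lintegral_congr fun x => ?_
  rw [ENNReal.ofReal_pow Metric.infDist_nonneg, Metric.infDist,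
    ENNReal.ofReal_toReal (Metric.infEDist_ne_top hM)]

lemma lowerSemicontinuous_meanSqDist (M : Set (Space d)) :
    LowerSemicontinuous (meanSqDist M) := by
  have hbdd : BddBelow (Set.range fun x => Metric.infDist x M ^ 2) :=
    ⟨0, Set.forall_mem_range.2 fun _ => sq_nonneg _⟩
  rw [← lowerSemicontinuousOn_univ_iff]
  exact (lowerSemicontinuousOn_integral (by fun_prop) hbdd).comp
    continuous_subtype_val.continuousOn fun ρ _ => integrable_infDist_sq M ρ

lemma meanSqDist_eq_zero_iff (hMc : IsClosed M) (hM : M.Nonempty) {ρ : P2 d} :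
    meanSqDist M ρ = 0 ↔ ρ ∈ supportedIn M := by
  rw [meanSqDist, integral_eq_zero_iff_of_nonneg (fun _ => sq_nonneg _) (integrable_infDist_sq M ρ)]
  exact eventually_congr (Eventually.of_forall fun x =>
    (pow_eq_zero_iff two_ne_zero).trans (hMc.mem_iff_infDist_zero hM).symm)

lemma supportedIn_nonempty (hM : M.Nonempty) : (supportedIn M).Nonempty := by
  obtain ⟨m, hm⟩ := hM
  refine ⟨⟨⟨Measure.dirac m, inferInstance⟩, ?_⟩, ?_⟩
  · rw [ProbabilityMeasure.coe_mk, lintegral_dirac]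
    finiteness
  · change Measure.dirac m Mᶜ = 0
    simpa [Measure.dirac_apply] using hm

lemma isCompact_setOf_meanSqDist_le (hMb : Bornology.IsBounded M) (hM : M.Nonempty) (K : ℝ) :
    IsCompact {ρ : P2 d | meanSqDist M ρ ≤ K} := by
  have hcoer : Tendsto (fun x => Metric.infEDist x M ^ 2) (cocompact (Space d)) (𝓝 ∞) := by
    simpa using (tendsto_infEDist_cocompact hMb hM).ennrpow_const 2
  have hcompact : IsCompact {ρ : P2 d | ∫⁻ x, Metric.infEDist x M ^ 2 ∂ρ.meas ≤
      ENNReal.ofReal K} :=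
    (IsInducing.subtypeVal.isCompact_preimage_iff fun μ hμ =>
      ⟨⟨μ, lintegral_enorm_sq_lt_top_of_infEDist hMb hM (lt_of_le_of_lt hμ ENNReal.ofReal_lt_top)⟩,
        rfl⟩).2
      (isCompact_setOf_lintegral_le (by fun_prop) hcoer ENNReal.ofReal_ne_top)
  refine hcompact.of_isClosed_subset
    ((lowerSemicontinuous_meanSqDist M).isClosed_preimage K) fun ρ hρ => ?_
  rw [Set.mem_ofPred_eq, lintegral_infEDist_sq hM]
  exact ENNReal.ofReal_le_ofReal hρ

end Penalization

section Interaction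

lemma isBigO_top_of_isBigO_cocompact {X E : Type*} [TopologicalSpace X] [SeminormedAddCommGroup E]
    {f : X → E} (hf : Continuous f) {g : X → ℝ} (hg : ∀ x, 1 ≤ g x) (h : f =O[cocompact X] g) :
    f =O[⊤] g := by
  obtain ⟨C, hC⟩ := h.bound
  obtain ⟨K, hK, hKC⟩ := mem_cocompact.1 hC
  obtain ⟨B, hB⟩ := hK.exists_bound_of_continuousOn hf.continuousOn
  refine Asymptotics.isBigO_top.2 ⟨max B C, fun x => ?_⟩
  by_cases hx : x ∈ K
  · have hB0 : 0 ≤ B := (norm_nonneg _).trans (hB x hx)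
    calc ‖f x‖ ≤ max B C * 1 := by simpa using Or.inl (hB x hx)
      _ ≤ max B C * ‖g x‖ :=
        mul_le_mul_of_nonneg_left ((hg x).trans (Real.le_norm_self _)) (le_max_of_le_left hB0)
  · exact (hKC hx).out.trans (by gcongr; exact le_max_right _ _)

variable {W : Space d → ℝ}

lemma integrable_interaction (hWc : Continuous W)
    (hWg : W =O[Bornology.cobounded (Space d)] fun x => ‖x‖ ^ 2) (ρ : P2 d) :
    Integrable (fun z : Space d × Space d => W (z.1 - z.2)) (ρ.meas.prod ρ.meas) := by
  have hsq : (fun x : Space d => ‖x‖ ^ 2) =O[cocompact (Space d)] fun x => 1 + ‖x‖ ^ 2 :=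
    Asymptotics.isBigO_of_le _ fun x => by
      rw [Real.norm_of_nonneg (by positivity), Real.norm_of_nonneg (by positivity)]
      exact le_add_of_nonneg_left zero_le_one
  have hbound : W =O[⊤] fun x => 1 + ‖x‖ ^ 2 :=
    isBigO_top_of_isBigO_cocompact hWc (fun x => le_add_of_nonneg_right (sq_nonneg _))
      ((Metric.cobounded_eq_cocompact (α := Space d) ▸ hWg).trans hsq)
  have hsub : MemLp (fun z : Space d × Space d => z.1 - z.2) 2 (ρ.meas.prod ρ.meas) :=
    (ρ.memLp_id.comp_fst ρ.meas).sub (ρ.memLp_id.comp_snd ρ.meas)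
  exact (hbound.comp_tendsto tendsto_top).integrable (by fun_prop)
    ((integrable_const 1).add hsub.norm.integrable_sq)

lemma interactionEnergy_eq_integral_prod (hWc : Continuous W)
    (hWg : W =O[Bornology.cobounded (Space d)] fun x => ‖x‖ ^ 2) (ρ : P2 d) :
    interactionEnergy W ρ = 1 / 2 * ∫ z, W (z.1 - z.2) ∂ρ.meas.prod ρ.meas := by
  rw [integral_prod _ (integrable_interaction hWc hWg ρ)]
  rfl

lemma bddBelow_range_interactionEnergy (hWc : Continuous W)
    (hWg : W =O[Bornology.cobounded (Space d)] fun x => ‖x‖ ^ 2)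
    (hWb : BddBelow (Set.range W)) : BddBelow (Set.range (interactionEnergy W)) := by
  obtain ⟨c, hc⟩ := hWb
  refine ⟨1 / 2 * c, Set.forall_mem_range.2 fun ρ => ?_⟩
  rw [interactionEnergy_eq_integral_prod hWc hWg]
  gcongr
  simpa using integral_mono (integrable_const c) (integrable_interaction hWc hWg ρ)
    fun z => hc ⟨z.1 - z.2, rfl⟩

lemma lowerSemicontinuous_interactionEnergy (hWc : Continuous W)
    (hWg : W =O[Bornology.cobounded (Space d)] fun x => ‖x‖ ^ 2)
    (hWb : BddBelow (Set.range W)) : LowerSemicontinuous (interactionEnergy W) := by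
  have hint : LowerSemicontinuous fun ρ : P2 d => ∫ z, W (z.1 - z.2) ∂ρ.meas.prod ρ.meas := by
    rw [← lowerSemicontinuousOn_univ_iff]
    exact (lowerSemicontinuousOn_integral
        (f := fun z : Space d × Space d => W (z.1 - z.2)) (by fun_prop)
        (hWb.mono (Set.range_subset_iff.2 fun z => Set.mem_range_self (z.1 - z.2)))).comp
      (g := fun ρ : P2 d => ρ.1.prod ρ.1)
      (ProbabilityMeasure.continuous_prod.comp
        (continuous_subtype_val.prodMk continuous_subtype_val)).continuousOn
      fun ρ _ => integrable_interaction hWc hWg ρ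
  rw [funext (interactionEnergy_eq_integral_prod hWc hWg)]
  exact (continuous_const_mul (1 / 2 : ℝ)).comp_lowerSemicontinuous hint
    (monotone_mul_left_of_nonneg one_half_pos.le)

end Interaction

section Minimizers

variable {M : Set (Space d)} {W : Space d → ℝ}

lemma isMinimizer_energyEps_iff {ε : ℝ} {ρ : P2 d} :
    IsMinimizer (energyEps W M ε) ρ ↔ ∀ μ, interactionEnergy W ρ + 1 / ε * meanSqDist M ρ ≤
      interactionEnergy W μ + 1 / ε * meanSqDist M μ :=
  forall_congr' fun _ => EReal.coe_le_coe_iff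

lemma energy_of_mem {ρ : P2 d} (hρ : ρ ∈ supportedIn M) :
    energy W M ρ = interactionEnergy W ρ := by
  rw [energy, if_pos hρ, Measure.restrict_eq_self_of_ae_mem hρ, interactionEnergy]

lemma isMinimizer_energy_of_forall_mem {ρ : P2 d} (hρ : ρ ∈ supportedIn M)
    (hmin : ∀ μ ∈ supportedIn M, interactionEnergy W ρ ≤ interactionEnergy W μ) :
    IsMinimizer (energy W M) ρ := by
  intro μ
  by_cases hμ : μ ∈ supportedIn M
  · rw [energy_of_mem hρ, energy_of_mem hμ]
    exact EReal.coe_le_coe_iff.2 (hmin μ hμ)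
  · exact le_top.trans_eq (if_neg hμ).symm

lemma meanSqDist_le_of_add_le {c ε K : ℝ} (hε : 0 < ε) {ρ : P2 d} (hc : c ≤ interactionEnergy W ρ)
    (hK : interactionEnergy W ρ + 1 / ε * meanSqDist M ρ ≤ K) :
    meanSqDist M ρ ≤ ε * (K - c) := by
  rw [← inv_mul_le_iff₀ hε, ← one_div]
  linarith

lemma exists_isMinimizer_energyEps (hMc : IsCompact M) (hM : M.Nonempty) (hWc : Continuous W)
    (hWg : W =O[Bornology.cobounded (Space d)] fun x => ‖x‖ ^ 2) (hWb : BddBelow (Set.range W))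
    {ε : ℝ} (hε : 0 < ε) : ∃ ρ : P2 d, IsMinimizer (energyEps W M ε) ρ := by
  obtain ⟨c, hc⟩ := bddBelow_range_interactionEnergy hWc hWg hWb
  obtain ⟨ρ₀, -⟩ := supportedIn_nonempty hM
  set F : P2 d → ℝ := fun ρ => interactionEnergy W ρ + 1 / ε * meanSqDist M ρ
  have hF : LowerSemicontinuous F := (lowerSemicontinuous_interactionEnergy hWc hWg hWb).add
    ((continuous_const_mul (1 / ε)).comp_lowerSemicontinuous (lowerSemicontinuous_meanSqDist M)
      (monotone_mul_left_of_nonneg (one_div_pos.2 hε).le))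
  have hsub {ρ : P2 d} (hρ : F ρ ≤ F ρ₀) : meanSqDist M ρ ≤ ε * (F ρ₀ - c) :=
    meanSqDist_le_of_add_le hε (hc ⟨ρ, rfl⟩) hρ
  obtain ⟨ρ, -, hρ⟩ := (hF.lowerSemicontinuousOn _).exists_isMinOn ⟨ρ₀, hsub le_rfl⟩
    (isCompact_setOf_meanSqDist_le hMc.isBounded hM (ε * (F ρ₀ - c)))
  refine ⟨ρ, isMinimizer_energyEps_iff.2 fun μ => ?_⟩
  rcases le_total (F μ) (F ρ₀) with hμ | hμ
  · exact hρ (hsub hμ)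
  · exact (hρ (hsub le_rfl)).out.trans hμ

lemma IsMinimizer.interactionEnergy_add_le {ε : ℝ} {ρ ν : P2 d} (hMc : IsClosed M)
    (hM : M.Nonempty) (hρ : IsMinimizer (energyEps W M ε) ρ) (hν : ν ∈ supportedIn M) :
    interactionEnergy W ρ + 1 / ε * meanSqDist M ρ ≤ interactionEnergy W ν := by
  simpa [(meanSqDist_eq_zero_iff hMc hM).2 hν] using isMinimizer_energyEps_iff.1 hρ ν

lemma isMinimizer_energy_of_tendsto (hMc : IsClosed M) (hM : M.Nonempty) (hWc : Continuous W)
    (hWg : W =O[Bornology.cobounded (Space d)] fun x => ‖x‖ ^ 2) (hWb : BddBelow (Set.range W))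
    {L : Type*} {l : Filter L} [l.NeBot] {ε : L → ℝ} (hε : ∀ n, 0 < ε n) {ρ : L → P2 d}
    (hρ : ∀ n, IsMinimizer (energyEps W M (ε n)) (ρ n)) {ρlim : P2 d}
    (hlim : Tendsto ρ l (𝓝 ρlim)) (hsupp : ρlim ∈ supportedIn M) :
    IsMinimizer (energy W M) ρlim := by
  refine isMinimizer_energy_of_forall_mem hsupp fun ν hν => ?_
  refine ((lowerSemicontinuous_interactionEnergy hWc hWg hWb).isClosed_preimage
    (interactionEnergy W ν)).mem_of_tendsto hlim (Eventually.of_forall fun n => ?_)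
  exact (le_add_of_nonneg_right (mul_nonneg (one_div_pos.2 (hε n)).le
    (meanSqDist_nonneg M _))).trans ((hρ n).interactionEnergy_add_le hMc hM hν)

lemma exists_forall_isMinimizer_meanSqDist_le (hMc : IsClosed M) (hM : M.Nonempty)
    (hWc : Continuous W) (hWg : W =O[Bornology.cobounded (Space d)] fun x => ‖x‖ ^ 2)
    (hWb : BddBelow (Set.range W)) :
    ∃ K : ℝ, ∀ ε > 0, ∀ ρ : P2 d, IsMinimizer (energyEps W M ε) ρ → meanSqDist M ρ ≤ ε * K := by
  obtain ⟨c, hc⟩ := bddBelow_range_interactionEnergy hWc hWg hWb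
  obtain ⟨ν, hν⟩ := supportedIn_nonempty hM
  exact ⟨interactionEnergy W ν - c, fun ε hε ρ hρ =>
    meanSqDist_le_of_add_le hε (hc ⟨ρ, rfl⟩) (hρ.interactionEnergy_add_le hMc hM hν)⟩

lemma exists_subseq_tendsto_of_tendsto_meanSqDist (hMc : IsCompact M) (hM : M.Nonempty)
    {ρ : ℕ → P2 d} (hρ : Tendsto (fun n => meanSqDist M (ρ n)) atTop (𝓝 0)) :
    ∃ φ : ℕ → ℕ, StrictMono φ ∧ ∃ ρlim ∈ supportedIn M, Tendsto (ρ ∘ φ) atTop (𝓝 ρlim) ∧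
      Tendsto (fun k => wasserstein (ρ (φ k)) ρlim) atTop (𝓝 0) := by
  have : FirstCountableTopology (P2 d) := IsInducing.subtypeVal.firstCountableTopology
  obtain ⟨K, hK⟩ := hρ.bddAbove_range
  obtain ⟨ρlim, -, φ, hφ, hlim⟩ :=
    (isCompact_setOf_meanSqDist_le hMc.isBounded hM K).tendsto_subseq fun n => hK ⟨n, rfl⟩
  have hdist : Tendsto (fun k => meanSqDist M (ρ (φ k))) atTop (𝓝 0) := hρ.comp hφ.tendsto_atTop
  have hsupp : ρlim ∈ supportedIn M := (meanSqDist_eq_zero_iff hMc.isClosed hM).1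
    ((le_of_lowerSemicontinuous_of_tendsto (lowerSemicontinuous_meanSqDist M) hlim hdist).antisymm
      (meanSqDist_nonneg M ρlim))
  refine ⟨φ, hφ, ρlim, hsupp, hlim, tendsto_wasserstein hlim hMc hsupp ?_⟩
  simpa [lintegral_infEDist_sq hM] using ENNReal.tendsto_ofReal hdist

end Minimizers

end Space

end AttractingManifold

end

open AttractingManifold in
theorem lemma2p2_general {d : ℕ} (M : Set (Space d)) (hMc : IsCompact M) (hMne : M.Nonempty)
    (W : Space d → ℝ) (hWc : Continuous W) (hWb : BddBelow (Set.range W))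
    (hWg : W =O[Bornology.cobounded (Space d)] fun x => ‖x‖ ^ 2) :
    (∀ ε : ℝ, 0 < ε → ∃ ρ : P2 d, IsMinimizer (energyEps W M ε) ρ) ∧
    (∀ ρ : ℝ → P2 d, (∀ ε : ℝ, 0 < ε → IsMinimizer (energyEps W M ε) (ρ ε)) →
      ∀ e : ℕ → ℝ, (∀ n, 0 < e n) → Tendsto e atTop (𝓝 0) →
        ∃ φ : ℕ → ℕ, StrictMono φ ∧ ∃ ρlim : P2 d, ρlim ∈ supportedIn M ∧
          Tendsto (fun k => wasserstein (ρ (e (φ k))) ρlim) atTop (𝓝 0) ∧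
          IsMinimizer (energy W M) ρlim) := by
  refine ⟨fun ε => exists_isMinimizer_energyEps hMc hMne hWc hWg hWb, fun ρ hρ e he he0 => ?_⟩
  obtain ⟨K, hK⟩ := exists_forall_isMinimizer_meanSqDist_le hMc.isClosed hMne hWc hWg hWb
  have hdist : Tendsto (fun n => meanSqDist M (ρ (e n))) atTop (𝓝 0) :=
    squeeze_zero (fun n => meanSqDist_nonneg M _) (fun n => hK (e n) (he n) _ (hρ _ (he n)))
      (by simpa using he0.mul_const K)
  obtain ⟨φ, hφ, ρlim, hsupp, hlim, hW2⟩ :=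
    exists_subseq_tendsto_of_tendsto_meanSqDist hMc hMne hdist
  exact ⟨φ, hφ, ρlim, hsupp, hW2, isMinimizer_energy_of_tendsto hMc.isClosed hMne hWc hWg hWb
    (fun k => he (φ k)) (fun k => hρ _ (he (φ k))) hlim hsupp⟩

open AttractingManifold in
theorem lemma2p2 {d : ℕ} (M : Set (Space d)) (hMc : IsCompact M) (hMne : M.Nonempty)
    (hMr : 0 < reach M) (W : Space d → ℝ) (hW : IsAdmissiblePotential W) :
    (∀ ε : ℝ, 0 < ε → ∃ ρ : P2 d, IsMinimizer (energyEps W M ε) ρ) ∧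
    (∀ ρ : ℝ → P2 d, (∀ ε : ℝ, 0 < ε → IsMinimizer (energyEps W M ε) (ρ ε)) →
      ∀ e : ℕ → ℝ, (∀ n, 0 < e n) → Tendsto e atTop (𝓝 0) →
        ∃ φ : ℕ → ℕ, StrictMono φ ∧ ∃ ρlim : P2 d, ρlim ∈ supportedIn M ∧
          Tendsto (fun k => wasserstein (ρ (e (φ k))) ρlim) atTop (𝓝 0) ∧
          IsMinimizer (energy W M) ρlim) :=
  lemma2p2_general M hMc hMne W hW.contDiff.continuous hW.bddBelow hW.growth
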